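/- \textbf{Proposition (Feynman expansion of $Z_U$).} Let $A$ be a real symmetric positive-definite $d\times d$ matrix, let $A^{ij}=(A^{-1})_{ij}$, and let $Z_0=\int_{\mathbb R^d}e^{-\frac12\langle Ax,x\rangle}\,dx$. Let $U$ be a real polynomial in $x=(x^1,\dots,x^d)$ without terms of degree $<3$, and write it as $$U(x)=\sum_{k\ge3}\frac1{k!}\sum_{i_1,\dots,i_k=1}^d U_{i_1\dots i_k}\,x^{i_1}\cdots x^{i_k},\qquad U_{i_1\dots i_k}=\partial_{i_1}\cdots\partial_{i_k}U(0).$$ Let $$Z_U=\int_{\mathbb R^d}e^{-\frac12\langle Ax,x\rangle+\hbar U(x)}\,dx\in\mathbb R[[\hbar]]$$ be the perturbative partition function: the integrand is expanded as a formal power series in $\hbar$ and integrated coefficient by coefficient (all these integrals converge absolutely), so that the coefficient of $\hbar^n$ is $\frac1{n!}\int e^{-\frac12\langle Ax,x\rangle}U(x)^n\,dx$. Then, in $\mathbb R[[\hbar]]$, $$Z_U=Z_0\sum_{\Gamma\in\Gamma^0}\frac{\hbar^{|\Gamma|}}{|\operatorname{Aut}\Gamma|}\sum_{\text{labels}}\prod_{v}U_v\prod_{e}A^{-1}_e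 ,$$ and for every $n$ only finitely many $\Gamma$ contribute a non-zero term to the coefficient of $\hbar^n$. Here $\Gamma^0$ is the set of isomorphism classes of finite graphs (possibly empty or disconnected, with loops and multiple edges allowed) all of whose vertices have valence $\ge3$ (so there are no legs); $|\Gamma|$ is the number of vertices; an automorphism is a pair of bijections of the set of vertices and of the set of edge ends onto themselves that takes edges to edges and preserves incidence (so reversing a loop is a non-trivial automorphism); a label is an index in $\{1,\dots,d\}$ on each edge end; $U_v=U_{i_1\dots i_k}$ if $i_1,\dots,i_k$ are the labels at the vertex $v$; and $A^{-1}_e=A^{ij}$ if $i,j$ are the labels at the two ends of the edge $e$. More generally, let $U\in\mathbb R[[x^1,\dots,x^d]]$ be any formal power series without terms of degree $<3$. Then the same formula holds with $U(x)$ replaced by $U(tx)=\sum_m t^m U_m(x)$ ($U_m$ the homogeneous part of degree $m$), as an identity in $\mathbb R[[t]][[\hbar]]$: $$\int_{\mathbb R^d}e^{-\frac12\langle Ax,x\rangle+\hbar U(tx)}\,dx=Z_0\sum_{\Gamma\in\Gamma^0}\frac{\hbar^{|\Gamma|}\,t^{2|E(\Gamma)|}}{|\operatorname{Aut}\Gamma|}\sum_{\text{labels}}\prod_{v}U_v\prod_{e}A^{-1}_e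 ,$$ where the left side is again integrated coefficient by coefficient, $E(\Gamma)$ is the set of edges of $\Gamma$, and only finitely many $\Gamma$ contribute to each coefficient of $\hbar^nt^m$. -/

import Mathlib

open MeasureTheory
open scoped BigOperators Nat PowerSeries.WithPiTopology

/-- A finite graph without legs: vertices and edges are numbered, loops and multiple edges are
allowed, the graph may be empty or disconnected, and all vertices are internal, that is, of
valence at least `3`. The two ends of the edge `e` are `(e, false)` and `(e, true)`; the end `h` is
attached to the vertex `vertex h`. The numbering and the order of the two ends of an edge carry no
meaning: graphs are considered up to isomorphism below. -/
structure FeynmanGraph where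
  numVertices : ℕ
  numEdges : ℕ
  vertex : Fin numEdges × Bool → Fin numVertices
  valence_ge_three :
    ∀ v : Fin numVertices, 3 ≤ (Finset.univ.filter fun h => vertex h = v).card

namespace FeynmanGraph

/-- The other end of the same edge. -/
def otherEnd {n : ℕ} (h : Fin n × Bool) : Fin n × Bool := (h.1, !h.2)

/-- An isomorphism of graphs: a bijection of the vertices and a bijection of the edge ends, which
takes edges to edges (the two ends of an edge to the two ends of an edge) and preserves the
incidence relation. An isomorphism may exchange the two ends of an edge, and exchanging the two
ends of a loop is not the identity. -/
structure Iso (Γ Δ : FeynmanGraph) where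
  onVertices : Fin Γ.numVertices ≃ Fin Δ.numVertices
  onEnds : Fin Γ.numEdges × Bool ≃ Fin Δ.numEdges × Bool
  map_otherEnd : ∀ h, onEnds (otherEnd h) = otherEnd (onEnds h)
  map_vertex : ∀ h, onVertices (Γ.vertex h) = Δ.vertex (onEnds h)

/-- The identity isomorphism. -/
def Iso.refl (Γ : FeynmanGraph) : Iso Γ Γ where
  onVertices := Equiv.refl _
  onEnds := Equiv.refl _
  map_otherEnd _ := rfl
  map_vertex _ := rfl

/-- The inverse isomorphism. -/
def Iso.symm {Γ Δ : FeynmanGraph} (f : Iso Γ Δ) : Iso Δ Γ where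
  onVertices := f.onVertices.symm
  onEnds := f.onEnds.symm
  map_otherEnd h := by
    rw [Equiv.symm_apply_eq, f.map_otherEnd, Equiv.apply_symm_apply]
  map_vertex h := by
    rw [Equiv.symm_apply_eq, f.map_vertex, Equiv.apply_symm_apply]

/-- The composition of isomorphisms. -/
def Iso.trans {Γ Δ Θ : FeynmanGraph} (f : Iso Γ Δ) (g : Iso Δ Θ) : Iso Γ Θ where
  onVertices := f.onVertices.trans g.onVertices
  onEnds := f.onEnds.trans g.onEnds
  map_otherEnd h := by
    simp only [Equiv.trans_apply, f.map_otherEnd, g.map_otherEnd]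
  map_vertex h := by
    simp only [Equiv.trans_apply, f.map_vertex, g.map_vertex]

instance isoSetoid : Setoid FeynmanGraph where
  r Γ Δ := Nonempty (Iso Γ Δ)
  iseqv :=
    { refl := fun Γ => ⟨Iso.refl Γ⟩
      symm := fun ⟨f⟩ => ⟨f.symm⟩
      trans := fun ⟨f⟩ ⟨g⟩ => ⟨f.trans g⟩ }

/-- `|Aut Γ|`, the number of automorphisms of `Γ`. -/
noncomputable def autCard (Γ : FeynmanGraph) : ℕ := Nat.card (Iso Γ Γ)

/-- A labelling of `Γ` puts an index from `1, …, d` on each end of each edge. -/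
abbrev Labelling (Γ : FeynmanGraph) (d : ℕ) : Type := Fin Γ.numEdges × Bool → Fin d

/-- The labels at the vertex `v` as a multi-index: `i` occurs as often as there are edge ends
with the label `i` at `v`. -/
noncomputable def labelsAt (Γ : FeynmanGraph) {d : ℕ} (l : Γ.Labelling d)
    (v : Fin Γ.numVertices) : Fin d →₀ ℕ :=
  ∑ h ∈ Finset.univ.filter (fun h => Γ.vertex h = v), Finsupp.single (l h) 1

end FeynmanGraph

/-- The set of all graphs without legs: isomorphism classes of graphs. -/
abbrev FeynmanClass : Type := Quotient FeynmanGraph.isoSetoid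

/-- The coefficient `U_{i₁…iₖ} = ∂_{i₁} ⋯ ∂_{iₖ} U (0)` of a potential, where `α` is the multi-index
of `i₁, …, iₖ`. In other words, the `U_{i₁…iₖ}` are symmetric and
`U(x) = ∑ₖ (1 / k!) ∑_{i₁,…,iₖ} U_{i₁…iₖ} x^{i₁} ⋯ x^{iₖ}`. -/
noncomputable def potentialCoeff {d : ℕ} (U : MvPowerSeries (Fin d) ℝ) (α : Fin d →₀ ℕ) : ℝ :=
  (∏ i, ((α i)! : ℝ)) * MvPowerSeries.coeff α U

/-- `(1 / |Aut Γ|) ∑_{labels} ∏_v U_v ∏_e A⁻¹_e`. -/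
noncomputable def feynmanWeight {d : ℕ} (A : Matrix (Fin d) (Fin d) ℝ)
    (U : MvPowerSeries (Fin d) ℝ) (Γ : FeynmanGraph) : ℝ :=
  1 / (Γ.autCard : ℝ) *
    ∑ l : Γ.Labelling d,
      (∏ v, potentialCoeff U (Γ.labelsAt l v)) * ∏ e, A⁻¹ (l (e, false)) (l (e, true))

/-- The Gaussian density `exp (-½ ⟨A x, x⟩)`. -/
noncomputable def gaussWeight {d : ℕ} (A : Matrix (Fin d) (Fin d) ℝ) (x : Fin d → ℝ) : ℝ :=
  Real.exp (-(1 / 2) * dotProduct (A.mulVec x) x)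

/-- `Z₀ = ∫ exp (-½ ⟨A x, x⟩) dx`. -/
noncomputable def gaussIntegral {d : ℕ} (A : Matrix (Fin d) (Fin d) ℝ) : ℝ :=
  ∫ x : Fin d → ℝ, gaussWeight A x

section PolynomialPotential

/-- The integrand `exp (-½ ⟨A x, x⟩ + ħ U(x))` at the point `x`, as a formal power series in `ħ`:
`exp (-½ ⟨A x, x⟩)` times the exponential series at `ħ U(x)`. -/
noncomputable def pertIntegrand {d : ℕ} (A : Matrix (Fin d) (Fin d) ℝ)
    (U : MvPolynomial (Fin d) ℝ) (x : Fin d → ℝ) : PowerSeries ℝ :=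
  gaussWeight A x • PowerSeries.rescale (MvPolynomial.eval x U) (PowerSeries.exp ℝ)

/-- The perturbative partition function `Z_U = ∫ exp (-½ ⟨A x, x⟩ + ħ U(x)) dx`, a formal power
series in `ħ`: the integrand is integrated coefficient by coefficient. -/
noncomputable def partitionFunction {d : ℕ} (A : Matrix (Fin d) (Fin d) ℝ)
    (U : MvPolynomial (Fin d) ℝ) : PowerSeries ℝ :=
  PowerSeries.mk fun n => ∫ x : Fin d → ℝ, PowerSeries.coeff n (pertIntegrand A U x)

/-- The term `ħ^{|Γ|} / |Aut Γ| ∑_{labels} ∏_v U_v ∏_e A⁻¹_e` of an isomorphism class of graphs,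
computed on a representative; `|Γ|` is the number of vertices. -/
noncomputable def feynmanTerm {d : ℕ} (A : Matrix (Fin d) (Fin d) ℝ)
    (U : MvPolynomial (Fin d) ℝ) (q : FeynmanClass) : PowerSeries ℝ :=
  PowerSeries.monomial q.out.numVertices
    (feynmanWeight A (U : MvPowerSeries (Fin d) ℝ) q.out)

end PolynomialPotential

section FormalPotential

/-- For a formal power series `U` in the coordinates, `U(t x) = ∑ₘ tᵐ Uₘ(x)` as a formal power
series in `t`, where `Uₘ` is the homogeneous part of degree `m` of `U`. -/
noncomputable def scaledPotential {d : ℕ} (U : MvPowerSeries (Fin d) ℝ) (x : Fin d → ℝ) :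
    PowerSeries ℝ :=
  PowerSeries.mk fun m =>
    ∑ α ∈ Finset.finsuppAntidiag (Finset.univ : Finset (Fin d)) m,
      MvPowerSeries.coeff α U * ∏ i, x i ^ α i

/-- The integrand `exp (-½ ⟨A x, x⟩ + ħ U(t x))` at the point `x`, as a formal power series in `ħ`
with coefficients in `ℝ⟦t⟧`. -/
noncomputable def formalPertIntegrand {d : ℕ} (A : Matrix (Fin d) (Fin d) ℝ)
    (U : MvPowerSeries (Fin d) ℝ) (x : Fin d → ℝ) : PowerSeries (PowerSeries ℝ) :=
  gaussWeight A x •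
    PowerSeries.rescale (scaledPotential U x) (PowerSeries.exp (PowerSeries ℝ))

/-- The partition function `∫ exp (-½ ⟨A x, x⟩ + ħ U(t x)) dx` in `ℝ⟦t⟧⟦ħ⟧`: the integrand is
integrated coefficient by coefficient. -/
noncomputable def formalPartitionFunction {d : ℕ} (A : Matrix (Fin d) (Fin d) ℝ)
    (U : MvPowerSeries (Fin d) ℝ) : PowerSeries (PowerSeries ℝ) :=
  PowerSeries.mk fun n => PowerSeries.mk fun m =>
    ∫ x : Fin d → ℝ, PowerSeries.coeff m (PowerSeries.coeff n (formalPertIntegrand A U x))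

/-- The term of a graph for the potential `U(t x)`: each vertex of valence `k` carries an
additional factor `tᵏ`, in total `t` to the number of edge ends, `2 |edges|`. -/
noncomputable def formalFeynmanTerm {d : ℕ} (A : Matrix (Fin d) (Fin d) ℝ)
    (U : MvPowerSeries (Fin d) ℝ) (q : FeynmanClass) : PowerSeries (PowerSeries ℝ) :=
  PowerSeries.monomial q.out.numVertices
    (PowerSeries.monomial (2 * q.out.numEdges) (feynmanWeight A U q.out))

end FormalPotential

/-! The coefficient of `ħⁿ` is `1/n!` times the Gaussian integral `⟨Uⁿ⟩`. Integration by parts gives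
`⟨xⁱ P⟩ = ∑ⱼ A⁻¹ᵢⱼ ⟨∂ⱼ P⟩` (`gaussMoment_X_mul`). With Euler's identity, `m ⟨P⟩ = ∑ A⁻¹ᵢⱼ ⟨∂ⱼ ∂ᵢ P⟩`
for `P` homogeneous of degree `m`. Odd moments therefore vanish, and iteration in degree `2k`
produces the factor `2k (2k - 2) ⋯ 2 = 2ᵏ k!`: this is Wick's theorem,
`gaussMoment_of_isHomogeneous_two_mul`, with numbered and oriented edges in place of pairings.

For the degree `2k` part of `Uⁿ`, the Leibniz rule `potentialCoeff_prod` sends each of the `2k`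
derivatives to one of the `n` factors. Such a choice is an incidence map from edge ends to vertices,
so the contribution is `Z₀ / (n! 2ᵏ k!)` times the sum of `labelSum` over all incidence maps. Maps
with a vertex of valence below `3` contribute nothing.

Renumberings of the vertices and edge ends form a group of order `n! 2ᵏ k!` acting on incidence
maps. Orbits are isomorphism classes and stabilizers are automorphism groups, so each class receives
the weight `1 / |Aut Γ|` (`card_toClass_fiber_mul_autCard`). In the formal case the power `t²ᵏ`
fixes the number of edges; in the polynomial case the degree of `U` bounds it. -/

namespace Matrix.PosDef

variable {d : ℕ} {A : Matrix (Fin d) (Fin d) ℝ}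

/-- Compactness of the unit sphere and homogeneity of the form. The bound lets a product of
one-variable Gaussians dominate the weight. -/
lemma exists_pos_mul_sum_sq_le (hA : A.PosDef) :
    ∃ c : ℝ, 0 < c ∧ ∀ x : Fin d → ℝ, c * ∑ i, x i ^ 2 ≤ A.mulVec x ⬝ᵥ x := by
  have hcont : Continuous fun x : Fin d → ℝ => A.mulVec x ⬝ᵥ x := by
    unfold dotProduct mulVec dotProduct
    fun_prop
  have hpos : ∀ x : Fin d → ℝ, x ≠ 0 → 0 < A.mulVec x ⬝ᵥ x := fun x hx => by
    have := hA.dotProduct_mulVec_pos hx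
    rwa [star_trivial, dotProduct_comm] at this
  obtain ⟨m, hm, hmle⟩ : ∃ m : ℝ, 0 < m ∧
      ∀ x ∈ Metric.sphere (0 : Fin d → ℝ) 1, m ≤ A.mulVec x ⬝ᵥ x := by
    -- The sphere is empty when `d = 0`; any positive constant then serves.
    rcases (Metric.sphere (0 : Fin d → ℝ) 1).eq_empty_or_nonempty with h | h
    · exact ⟨1, one_pos, by simp [h]⟩
    · obtain ⟨y, hy, hmin⟩ := (isCompact_sphere (0 : Fin d → ℝ) 1).exists_isMinOn h
        hcont.continuousOn
      refine ⟨_, hpos y ?_, fun x hx => hmin hx⟩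
      rintro rfl
      simp at hy
  have hnorm : ∀ x : Fin d → ℝ, m * ‖x‖ ^ 2 ≤ A.mulVec x ⬝ᵥ x := by
    intro x
    rcases eq_or_ne x 0 with rfl | hx
    · simp
    have hx' : ‖x‖ ≠ 0 := norm_ne_zero_iff.mpr hx
    have h := hmle (‖x‖⁻¹ • x) (by simp [norm_smul, hx'])
    rw [mulVec_smul, smul_dotProduct, dotProduct_smul, smul_eq_mul, smul_eq_mul] at h
    have h2 : 0 < ‖x‖ ^ 2 := by positivity
    calc m * ‖x‖ ^ 2 ≤ (‖x‖⁻¹ * (‖x‖⁻¹ * (A.mulVec x ⬝ᵥ x))) * ‖x‖ ^ 2 := by gcongr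
      _ = _ := by field_simp
  -- The norm is the sup norm, so the sum of squares is at most `d ‖x‖²`; `d + 1` avoids division by
  -- zero.
  refine ⟨m / (d + 1), by positivity, fun x => le_trans ?_ (hnorm x)⟩
  have hsum : ∑ i, x i ^ 2 ≤ d * ‖x‖ ^ 2 := by
    calc ∑ i, x i ^ 2 ≤ ∑ _i : Fin d, ‖x‖ ^ 2 := Finset.sum_le_sum fun i _ => by
          rw [← sq_abs]
          gcongr
          exact norm_le_pi_norm x i
      _ = _ := by simp
  have : m / (d + 1) * ∑ i, x i ^ 2 ≤ m / (d + 1) * ((d + 1) * ‖x‖ ^ 2) := by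
    gcongr
    nlinarith [sq_nonneg ‖x‖]
  refine this.trans_eq ?_
  field_simp

end Matrix.PosDef

/-! ### Gaussian moments and Wick's theorem -/

section GaussianMoments

variable {d : ℕ} {A : Matrix (Fin d) (Fin d) ℝ}

lemma continuous_gaussWeight (A : Matrix (Fin d) (Fin d) ℝ) : Continuous (gaussWeight A) := by
  unfold gaussWeight dotProduct Matrix.mulVec dotProduct
  fun_prop

lemma integrable_pow_mul_exp_neg_mul_sq {c : ℝ} (hc : 0 < c) (k : ℕ) :
    Integrable fun x : ℝ => x ^ k * Real.exp (-c * x ^ 2) := by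
  have h := integrable_rpow_mul_exp_neg_mul_sq hc (s := k)
    (lt_of_lt_of_le (by norm_num) (Nat.cast_nonneg k))
  simpa only [Real.rpow_natCast] using h

lemma integrable_gaussWeight_mul_monomial (hA : A.PosDef) (α : Fin d →₀ ℕ) :
    Integrable fun x : Fin d → ℝ => gaussWeight A x * ∏ i, x i ^ α i := by
  obtain ⟨c, hc, hle⟩ := hA.exists_pos_mul_sum_sq_le
  have hprod : Integrable fun x : Fin d → ℝ =>
      ∏ i, (x i ^ α i * Real.exp (-(c / 2) * x i ^ 2)) :=
    Integrable.fintype_prod fun i => integrable_pow_mul_exp_neg_mul_sq (half_pos hc) (α i)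
  refine hprod.mono ?_ (Filter.Eventually.of_forall fun x => ?_)
  · exact ((continuous_gaussWeight A).mul (by fun_prop)).aestronglyMeasurable
  · rw [Finset.prod_mul_distrib, ← Real.exp_sum, ← Finset.mul_sum, mul_comm, norm_mul, norm_mul]
    gcongr
    rw [gaussWeight, Real.norm_of_nonneg (Real.exp_pos _).le,
      Real.norm_of_nonneg (Real.exp_pos _).le]
    refine Real.exp_le_exp.mpr ?_
    linarith [hle x]

lemma integrable_gaussWeight_mul_eval (hA : A.PosDef) (P : MvPolynomial (Fin d) ℝ) :
    Integrable fun x : Fin d → ℝ => gaussWeight A x * MvPolynomial.eval x P := by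
  simp_rw [MvPolynomial.eval_eq', Finset.mul_sum]
  refine integrable_finsetSum _ fun α _ => ?_
  simpa only [mul_left_comm] using
    (integrable_gaussWeight_mul_monomial hA α).const_mul (MvPolynomial.coeff α P)

/-- The linear functional `P ↦ ∫ exp (-½ ⟨A x, x⟩) P(x) dx` on polynomials. -/
noncomputable def gaussMoment (hA : A.PosDef) : MvPolynomial (Fin d) ℝ →ₗ[ℝ] ℝ where
  toFun P := ∫ x : Fin d → ℝ, gaussWeight A x * MvPolynomial.eval x P
  map_add' P Q := by
    simp_rw [map_add, mul_add]
    exact integral_add (integrable_gaussWeight_mul_eval hA P)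
      (integrable_gaussWeight_mul_eval hA Q)
  map_smul' c P := by
    simp_rw [MvPolynomial.smul_eval, mul_left_comm _ c]
    exact integral_const_mul _ _

lemma gaussMoment_apply (hA : A.PosDef) (P : MvPolynomial (Fin d) ℝ) :
    gaussMoment hA P = ∫ x : Fin d → ℝ, gaussWeight A x * MvPolynomial.eval x P := rfl

lemma gaussMoment_C (hA : A.PosDef) (c : ℝ) :
    gaussMoment hA (MvPolynomial.C c) = gaussIntegral A * c := by
  simp only [gaussMoment_apply, MvPolynomial.eval_C, gaussIntegral]
  exact integral_mul_const _ _

lemma MvPolynomial.hasLineDerivAt_eval (P : MvPolynomial (Fin d) ℝ) (x : Fin d → ℝ) (i : Fin d) :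
    HasLineDerivAt ℝ (fun y => MvPolynomial.eval y P)
      (MvPolynomial.eval x (MvPolynomial.pderiv i P)) x (Pi.single i 1) := by
  unfold HasLineDerivAt
  induction P using MvPolynomial.induction_on with
  | C a => simpa using hasDerivAt_const (0 : ℝ) a
  | add P Q hP hQ =>
    simp only [map_add]
    exact hP.add hQ
  | mul_X P j hP =>
    have hX : HasDerivAt (fun t : ℝ => (x + t • (Pi.single i 1 : Fin d → ℝ)) j)
        ((Pi.single i 1 : Fin d → ℝ) j) 0 := by
      simpa using ((hasDerivAt_id (0 : ℝ)).mul_const ((Pi.single i 1 : Fin d → ℝ) j)).const_add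
        (x j)
    have := hP.mul hX
    simp only [MvPolynomial.pderiv_mul, MvPolynomial.pderiv_X, map_add, map_mul,
      MvPolynomial.eval_X]
    convert! this using 1
    simp only [zero_smul, add_zero]
    congr 2
    rcases eq_or_ne i j with rfl | h
    · simp
    · simp [h.symm]

lemma hasLineDerivAt_gaussWeight (hA : A.PosDef) (x : Fin d → ℝ) (i : Fin d) :
    HasLineDerivAt ℝ (gaussWeight A) (-(A.mulVec x i) * gaussWeight A x) x (Pi.single i 1) := by
  unfold HasLineDerivAt gaussWeight
  set v : Fin d → ℝ := Pi.single i 1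
  have hsymm : A.mulVec v ⬝ᵥ x = A.mulVec x i := by
    have hT : A.transpose = A := hA.isHermitian
    rw [dotProduct_comm, Matrix.dotProduct_mulVec, ← Matrix.mulVec_transpose, hT]
    simp [v]
  have hv : A.mulVec x ⬝ᵥ v = A.mulVec x i := by simp [v]
  have hexp : ∀ t : ℝ, A.mulVec (x + t • v) ⬝ᵥ (x + t • v) =
      A.mulVec x ⬝ᵥ x + t * (2 * A.mulVec x i) + t ^ 2 * (A.mulVec v ⬝ᵥ v) := by
    intro t
    simp only [Matrix.mulVec_add, Matrix.mulVec_smul, add_dotProduct, dotProduct_add,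
      smul_dotProduct, dotProduct_smul, smul_eq_mul, hsymm, hv]
    ring
  simp_rw [hexp]
  have h1 : HasDerivAt (fun t : ℝ => -(1 / 2) * (A.mulVec x ⬝ᵥ x + t * (2 * A.mulVec x i) +
      t ^ 2 * (A.mulVec v ⬝ᵥ v))) (-(A.mulVec x i)) 0 := by
    have := ((((hasDerivAt_id (0 : ℝ)).mul_const (2 * A.mulVec x i)).const_add
      (A.mulVec x ⬝ᵥ x)).add (((hasDerivAt_id (0 : ℝ)).pow 2).mul_const
        (A.mulVec v ⬝ᵥ v))).const_mul (-(1 / 2) : ℝ)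
    convert! this using 1
    simp
  convert! h1.exp using 1
  simp [mul_comm]

/-- Integration by parts: the derivative of the weight in direction `i` is `-(A x)ᵢ` times the
weight. -/
lemma gaussMoment_pderiv (hA : A.PosDef) (P : MvPolynomial (Fin d) ℝ) (i : Fin d) :
    gaussMoment hA (MvPolynomial.pderiv i P) =
      ∑ j, A i j * gaussMoment hA (MvPolynomial.X j * P) := by
  have hlin : ∀ x : Fin d → ℝ, MvPolynomial.eval x
      (∑ j, A i j • (MvPolynomial.X j * P)) = A.mulVec x i * MvPolynomial.eval x P := by
    intro x
    simp [Matrix.mulVec, dotProduct, Finset.sum_mul, mul_assoc]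
  have hparts := integral_bilinear_hasLineDerivAt_right_eq_neg_left_of_integrable
    (μ := (volume : Measure (Fin d → ℝ))) (B := ContinuousLinearMap.mul ℝ ℝ)
    (f := gaussWeight A) (f' := fun x => -(A.mulVec x i) * gaussWeight A x)
    (g := fun x => MvPolynomial.eval x P)
    (g' := fun x => MvPolynomial.eval x (MvPolynomial.pderiv i P)) (v := Pi.single i 1)
    (by
      refine (integrable_gaussWeight_mul_eval hA
        (∑ j, A i j • (MvPolynomial.X j * P))).neg.congr (Filter.Eventually.of_forall fun x => ?_)
      simp only [Pi.neg_apply, hlin, ContinuousLinearMap.mul_apply']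
      ring)
    (integrable_gaussWeight_mul_eval hA _) (integrable_gaussWeight_mul_eval hA _)
    (fun x _ => hasLineDerivAt_gaussWeight hA x i)
    (fun x _ => MvPolynomial.hasLineDerivAt_eval P x i)
  have hrhs : ∑ j, A i j * gaussMoment hA (MvPolynomial.X j * P) =
      gaussMoment hA (∑ j, A i j • (MvPolynomial.X j * P)) := by
    simp only [map_sum, map_smul, smul_eq_mul]
  rw [hrhs, gaussMoment_apply, gaussMoment_apply]
  simp only [ContinuousLinearMap.mul_apply'] at hparts
  rw [hparts, ← integral_neg]
  refine integral_congr_ae (Filter.Eventually.of_forall fun x => ?_)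
  simp only [hlin]
  ring

lemma gaussMoment_X_mul (hA : A.PosDef) (P : MvPolynomial (Fin d) ℝ) (i : Fin d) :
    gaussMoment hA (MvPolynomial.X i * P) =
      ∑ j, A⁻¹ i j * gaussMoment hA (MvPolynomial.pderiv j P) := by
  have hdet : IsUnit A.det := (Matrix.isUnit_iff_isUnit_det A).mp hA.isUnit
  have h : A.mulVec (fun j => gaussMoment hA (MvPolynomial.X j * P)) =
      fun j => gaussMoment hA (MvPolynomial.pderiv j P) := by
    ext j
    rw [gaussMoment_pderiv]
    rfl
  have h' := congrArg (A⁻¹.mulVec) h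
  rw [Matrix.mulVec_mulVec, Matrix.nonsing_inv_mul A hdet, Matrix.one_mulVec] at h'
  exact congrFun h' i

/-- Euler's identity `m P = ∑ xⁱ ∂ᵢ P`, after which integration by parts trades each `xⁱ` for a
second derivative. The recursion lowers the degree by two. -/
lemma gaussMoment_of_isHomogeneous (hA : A.PosDef) {P : MvPolynomial (Fin d) ℝ} {m : ℕ}
    (hP : P.IsHomogeneous m) :
    (m : ℝ) * gaussMoment hA P = ∑ p : Fin d × Fin d, A⁻¹ p.1 p.2 *
      gaussMoment hA (MvPolynomial.pderiv p.2 (MvPolynomial.pderiv p.1 P)) := by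
  have h := congrArg (gaussMoment hA) hP.sum_X_mul_pderiv
  rw [map_sum, map_nsmul, nsmul_eq_mul] at h
  rw [← h, Fintype.sum_prod_type]
  exact Finset.sum_congr rfl fun i _ => gaussMoment_X_mul hA _ i

/-- Odd Gaussian moments vanish. -/
lemma gaussMoment_eq_zero_of_odd (hA : A.PosDef) (k : ℕ) {P : MvPolynomial (Fin d) ℝ}
    (hP : P.IsHomogeneous (2 * k + 1)) : gaussMoment hA P = 0 := by
  induction k generalizing P with
  | zero =>
    have h := gaussMoment_of_isHomogeneous hA hP
    rw [Finset.sum_eq_zero] at h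
    · simpa using h
    · rintro ⟨i, j⟩ -
      have h0 : (MvPolynomial.pderiv i P).IsHomogeneous 0 := hP.pderiv
      rw [← MvPolynomial.totalDegree_zero_iff_isHomogeneous,
        MvPolynomial.totalDegree_eq_zero_iff_eq_C] at h0
      rw [h0, MvPolynomial.pderiv_C, map_zero, mul_zero]
  | succ k ih =>
    have h := gaussMoment_of_isHomogeneous hA hP
    rw [Finset.sum_eq_zero] at h
    · exact (mul_eq_zero.mp h).resolve_left (by positivity)
    · rintro ⟨i, j⟩ -
      have h2 : (MvPolynomial.pderiv j (MvPolynomial.pderiv i P)).IsHomogeneous (2 * k + 1) :=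
        (hP.pderiv (i := i)).pderiv
      rw [ih h2, mul_zero]

/-- The factorials absorb the factor `αᵢ + 1` produced by differentiation. -/
lemma potentialCoeff_pderiv (V : MvPowerSeries (Fin d) ℝ) (α : Fin d →₀ ℕ) (i : Fin d) :
    potentialCoeff (MvPowerSeries.pderiv ℝ i V) α = potentialCoeff V (α + Finsupp.single i 1) := by
  have hfact : ∏ j : Fin d, (((α + Finsupp.single i 1 : Fin d →₀ ℕ) j)! : ℝ) =
      (∏ j, ((α j)! : ℝ)) * (α i + 1) := by
    rw [← Finset.mul_prod_erase _ _ (Finset.mem_univ i),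
      ← Finset.mul_prod_erase _ (fun j => ((α j)! : ℝ)) (Finset.mem_univ i)]
    have h : ∏ j ∈ Finset.univ.erase i, (((α + Finsupp.single i 1 : Fin d →₀ ℕ) j)! : ℝ) =
        ∏ j ∈ Finset.univ.erase i, ((α j)! : ℝ) := by
      refine Finset.prod_congr rfl fun j hj => ?_
      rw [Finsupp.add_apply, Finsupp.single_eq_of_ne (Finset.ne_of_mem_erase hj), add_zero]
    rw [h, Finsupp.add_apply, Finsupp.single_eq_same, Nat.factorial_succ]
    push_cast
    ring
  rw [potentialCoeff, potentialCoeff, MvPowerSeries.coeff_pderiv, hfact]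
  ring

/-- **Wick's theorem** for homogeneous polynomials of even degree. -/
theorem gaussMoment_of_isHomogeneous_two_mul (hA : A.PosDef) (k : ℕ) {P : MvPolynomial (Fin d) ℝ}
    (hP : P.IsHomogeneous (2 * k)) :
    (2 ^ k * k ! : ℝ) * gaussMoment hA P = gaussIntegral A *
      ∑ p : Fin k → Fin d × Fin d, (∏ e, A⁻¹ (p e).1 (p e).2) *
        potentialCoeff (P : MvPowerSeries (Fin d) ℝ)
          (∑ e, (Finsupp.single (p e).1 1 + Finsupp.single (p e).2 1)) := by
  induction k generalizing P with
  | zero =>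
    have h0 : P.IsHomogeneous 0 := hP
    rw [← MvPolynomial.totalDegree_zero_iff_isHomogeneous,
        MvPolynomial.totalDegree_eq_zero_iff_eq_C] at h0
    rw [h0, gaussMoment_C]
    simp [potentialCoeff]
  | succ k ih =>
    have hstep : ∀ i j : Fin d,
        (MvPolynomial.pderiv j (MvPolynomial.pderiv i P)).IsHomogeneous (2 * k) :=
      fun i j => (hP.pderiv (i := i)).pderiv
    have h := gaussMoment_of_isHomogeneous hA hP
    -- The new factor `2 (k + 1)` is the degree of `P`, as required by Euler's identity.
    have hcast : (2 ^ (k + 1) * (k + 1)! : ℝ) * gaussMoment hA P =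
        (2 ^ k * k ! : ℝ) * (((2 * (k + 1) : ℕ) : ℝ) * gaussMoment hA P) := by
      rw [Nat.factorial_succ]
      push_cast
      ring
    rw [hcast, h, Finset.mul_sum]
    simp_rw [mul_left_comm (2 ^ k * k ! : ℝ), ih (hstep _ _)]
    -- The pair of indices split off is the edge created by this recursion step.
    have hcons := fun f : (Fin (k + 1) → Fin d × Fin d) → ℝ =>
      ((Fin.consEquiv fun _ : Fin (k + 1) => Fin d × Fin d).sum_comp f).symm.trans
        (Fintype.sum_prod_type _)
    rw [hcons, Finset.mul_sum]
    refine Finset.sum_congr rfl fun q _ => ?_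
    rw [mul_left_comm, Finset.mul_sum]
    congr 1
    refine Finset.sum_congr rfl fun p _ => ?_
    simp only [Fin.consEquiv_apply, Fin.prod_univ_succ, Fin.sum_univ_succ, Fin.cons_zero,
      Fin.cons_succ]
    rw [← MvPowerSeries.pderiv_coe, ← MvPowerSeries.pderiv_coe, potentialCoeff_pderiv,
      potentialCoeff_pderiv, mul_assoc]
    congr 3
    abel

end GaussianMoments

/-! ### The Leibniz rule for products of potentials -/

section Leibniz

variable {d : ℕ}

lemma potentialCoeff_sum {ι : Type*} (s : Finset ι) (V : ι → MvPowerSeries (Fin d) ℝ)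
    (α : Fin d →₀ ℕ) :
    potentialCoeff (∑ i ∈ s, V i) α = ∑ i ∈ s, potentialCoeff (V i) α := by
  simp only [potentialCoeff, map_sum, Finset.mul_sum]

lemma potentialCoeff_prod_zero {ι : Type*} [Fintype ι] (V : ι → MvPowerSeries (Fin d) ℝ) :
    potentialCoeff (∏ v, V v) 0 = ∏ v, potentialCoeff (V v) 0 := by
  simp [potentialCoeff]

/-- With `Function.update` each summand is again a product over the same index set, so the rule can
be iterated. -/
lemma Derivation.leibniz_prod_update {R B ι : Type*} [CommSemiring R] [CommSemiring B]
    [Algebra R B] [DecidableEq ι] (D : Derivation R B B) (s : Finset ι) (f : ι → B) :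
    D (∏ i ∈ s, f i) = ∑ i ∈ s, ∏ j ∈ s, Function.update f i (D (f i)) j := by
  induction s using Finset.induction_on with
  | empty => simp
  | insert a s ha ih =>
    rw [Finset.prod_insert ha, D.leibniz, ih, Finset.sum_insert ha, Finset.prod_insert ha,
      Function.update_self, smul_eq_mul, smul_eq_mul, Finset.mul_sum, add_comm]
    congr 1
    · rw [mul_comm, Finset.prod_update_of_notMem ha]
    · refine Finset.sum_congr rfl fun i hi => ?_
      rw [Finset.prod_insert ha, Function.update_of_ne (by rintro rfl; exact ha hi)]

/-- Induction on the number of derivatives, for all families at once: the first derivative replaces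
one factor `V u` by its derivative. -/
lemma potentialCoeff_prod_fin {ι : Type*} [Fintype ι] [DecidableEq ι] (N : ℕ)
    (V : ι → MvPowerSeries (Fin d) ℝ) (l : Fin N → Fin d) :
    potentialCoeff (∏ v, V v) (∑ h, Finsupp.single (l h) 1) =
      ∑ f : Fin N → ι, ∏ v, potentialCoeff (V v)
        (∑ h ∈ Finset.univ.filter fun h => f h = v, Finsupp.single (l h) 1) := by
  induction N generalizing V with
  | zero => simp [potentialCoeff_prod_zero]
  | succ N ih =>
    have hcons := fun F : (Fin (N + 1) → ι) → ℝ =>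
      ((Fin.consEquiv fun _ : Fin (N + 1) => ι).sum_comp F).symm.trans (Fintype.sum_prod_type _)
    rw [hcons, Fin.sum_univ_succ, add_comm, ← potentialCoeff_pderiv,
      Derivation.leibniz_prod_update, potentialCoeff_sum]
    refine Finset.sum_congr rfl fun u _ => ?_
    rw [ih]
    refine Finset.sum_congr rfl fun f _ => Finset.prod_congr rfl fun v _ => ?_
    simp only [Fin.consEquiv_apply, Finset.sum_filter, Fin.sum_univ_succ, Fin.cons_zero,
      Fin.cons_succ]
    rcases eq_or_ne u v with rfl | huv
    · rw [Function.update_self, potentialCoeff_pderiv, if_pos rfl, add_comm]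
    · rw [Function.update_of_ne huv.symm, if_neg huv, zero_add]

/-- The Leibniz rule for iterated partial derivatives at the origin: each derivative `h` is
applied to one of the factors, the factor `f h`. -/
lemma potentialCoeff_prod {ι H : Type*} [Fintype ι] [DecidableEq ι] [Fintype H] [DecidableEq H]
    (V : ι → MvPowerSeries (Fin d) ℝ) (l : H → Fin d) :
    potentialCoeff (∏ v, V v) (∑ h, Finsupp.single (l h) 1) =
      ∑ f : H → ι, ∏ v, potentialCoeff (V v)
        (∑ h ∈ Finset.univ.filter fun h => f h = v, Finsupp.single (l h) 1) := by
  let e := Fintype.equivFin H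
  have h := potentialCoeff_prod_fin (Fintype.card H) V (l ∘ e.symm)
  have h1 : ∑ k, Finsupp.single ((l ∘ e.symm) k) 1 = ∑ h, Finsupp.single (l h) 1 :=
    e.symm.sum_comp fun h => Finsupp.single (l h) 1
  rw [← h1, h]
  refine Fintype.sum_equiv (e.symm.arrowCongr (Equiv.refl ι)) _ _ fun f =>
    Finset.prod_congr rfl fun v _ => ?_
  congr 1
  simp only [Finset.sum_filter]
  exact Fintype.sum_equiv e.symm _ _ fun k => by simp

end Leibniz

/-! ### Homogeneous parts and the scaled potential -/

section HomogeneousPart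

variable {d : ℕ}

/-- The homogeneous part of degree `m` of a formal power series, as a polynomial. -/
noncomputable def homogeneousPart (V : MvPowerSeries (Fin d) ℝ) (m : ℕ) :
    MvPolynomial (Fin d) ℝ :=
  ∑ α ∈ Finset.finsuppAntidiag (Finset.univ : Finset (Fin d)) m,
    MvPolynomial.monomial α (MvPowerSeries.coeff α V)

lemma mem_finsuppAntidiag_univ {m : ℕ} {α : Fin d →₀ ℕ} :
    α ∈ Finset.finsuppAntidiag (Finset.univ : Finset (Fin d)) m ↔ α.degree = m := by
  simp [Finset.mem_finsuppAntidiag, Finsupp.degree_eq_sum]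

lemma coeff_homogeneousPart (V : MvPowerSeries (Fin d) ℝ) (m : ℕ) (α : Fin d →₀ ℕ) :
    MvPolynomial.coeff α (homogeneousPart V m) =
      if α.degree = m then MvPowerSeries.coeff α V else 0 := by
  classical
  simp only [homogeneousPart, MvPolynomial.coeff_sum, MvPolynomial.coeff_monomial,
    Finset.sum_ite_eq', mem_finsuppAntidiag_univ]

lemma homogeneousPart_isHomogeneous (V : MvPowerSeries (Fin d) ℝ) (m : ℕ) :
    (homogeneousPart V m).IsHomogeneous m :=
  MvPolynomial.IsHomogeneous.sum _ _ _ fun _ hα =>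
    MvPolynomial.isHomogeneous_monomial _ (mem_finsuppAntidiag_univ.mp hα)

lemma potentialCoeff_homogeneousPart (V : MvPowerSeries (Fin d) ℝ) {m : ℕ} {α : Fin d →₀ ℕ}
    (hα : α.degree = m) :
    potentialCoeff (homogeneousPart V m : MvPowerSeries (Fin d) ℝ) α = potentialCoeff V α := by
  rw [potentialCoeff, potentialCoeff, MvPolynomial.coeff_coe, coeff_homogeneousPart, if_pos hα]

lemma sum_range_homogeneousPart (P : MvPolynomial (Fin d) ℝ) {N : ℕ} (hN : P.totalDegree < N) :
    ∑ m ∈ Finset.range N, homogeneousPart (P : MvPowerSeries (Fin d) ℝ) m = P := by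
  ext α
  simp only [MvPolynomial.coeff_sum, coeff_homogeneousPart, MvPolynomial.coeff_coe,
    Finset.sum_ite_eq, Finset.mem_range]
  split_ifs with h
  · rfl
  · refine (MvPolynomial.coeff_eq_zero_of_totalDegree_lt ?_).symm
    rw [← Finsupp.degree_apply]
    omega

lemma coeff_scaledPotential (V : MvPowerSeries (Fin d) ℝ) (x : Fin d → ℝ) (m : ℕ) :
    PowerSeries.coeff m (scaledPotential V x) = MvPolynomial.eval x (homogeneousPart V m) := by
  simp [scaledPotential, homogeneousPart, MvPolynomial.eval_monomial, Finsupp.prod_fintype]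

/-- Used to turn powers of `U(t x)` in the exponential series into homogeneous parts of `Uⁿ`. -/
lemma scaledPotential_mul (V W : MvPowerSeries (Fin d) ℝ) (x : Fin d → ℝ) :
    scaledPotential (V * W) x = scaledPotential V x * scaledPotential W x := by
  classical
  ext m
  rw [PowerSeries.coeff_mul]
  simp only [scaledPotential, PowerSeries.coeff_mk, MvPowerSeries.coeff_mul, Finset.sum_mul_sum]
  simp_rw [← Finset.sum_product', Finset.sum_mul]
  rw [Finset.sum_sigma', Finset.sum_sigma']
  -- A pair of multi-indices determines both its sum and the degrees of its two members.
  refine Finset.sum_bij' (fun p _ => ⟨(p.2.1.degree, p.2.2.degree), p.2⟩)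
    (fun p _ => ⟨p.2.1 + p.2.2, p.2⟩) ?_ ?_ ?_ ?_ ?_
  · rintro ⟨α, β, γ⟩ h
    simp only [Finset.mem_sigma, mem_finsuppAntidiag_univ,
      Finset.HasAntidiagonal.mem_antidiagonal] at h
    simp only [Finset.mem_sigma, Finset.mem_product, mem_finsuppAntidiag_univ,
      Finset.HasAntidiagonal.mem_antidiagonal, and_self, and_true]
    rw [← h.1, ← h.2, map_add]
  · rintro ⟨⟨a, b⟩, β, γ⟩ h
    simp only [Finset.mem_sigma, Finset.mem_product, mem_finsuppAntidiag_univ,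
      Finset.HasAntidiagonal.mem_antidiagonal] at h
    simp only [Finset.mem_sigma, mem_finsuppAntidiag_univ, Finset.HasAntidiagonal.mem_antidiagonal,
      and_true]
    rw [map_add, h.2.1, h.2.2, h.1]
  · rintro ⟨α, β, γ⟩ h
    simp only [Finset.mem_sigma, mem_finsuppAntidiag_univ,
      Finset.HasAntidiagonal.mem_antidiagonal] at h
    simp [h.2]
  · rintro ⟨⟨a, b⟩, β, γ⟩ h
    simp only [Finset.mem_sigma, Finset.mem_product, mem_finsuppAntidiag_univ] at h
    simp [h.2.1, h.2.2]
  · rintro ⟨α, β, γ⟩ h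
    simp only [Finset.mem_sigma, Finset.HasAntidiagonal.mem_antidiagonal] at h
    simp only [← h.2, Finsupp.add_apply, pow_add, Finset.prod_mul_distrib]
    ring

lemma scaledPotential_one (x : Fin d → ℝ) : scaledPotential 1 x = 1 := by
  classical
  ext m
  rw [PowerSeries.coeff_one]
  simp only [scaledPotential, PowerSeries.coeff_mk, MvPowerSeries.coeff_one, ite_mul, one_mul,
    zero_mul, Finset.sum_ite_eq', mem_finsuppAntidiag_univ]
  simp [eq_comm]

lemma scaledPotential_pow (V : MvPowerSeries (Fin d) ℝ) (x : Fin d → ℝ) (n : ℕ) :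
    scaledPotential (V ^ n) x = scaledPotential V x ^ n := by
  induction n with
  | zero => simp [scaledPotential_one]
  | succ n ih => rw [pow_succ, pow_succ, scaledPotential_mul, ih]

end HomogeneousPart

/-! ### Coefficients of the integrands -/

section Integrands

variable {d : ℕ} {A : Matrix (Fin d) (Fin d) ℝ}

lemma coeff_pertIntegrand (A : Matrix (Fin d) (Fin d) ℝ) (U : MvPolynomial (Fin d) ℝ)
    (x : Fin d → ℝ) (n : ℕ) :
    PowerSeries.coeff n (pertIntegrand A U x) =
      (n ! : ℝ)⁻¹ * (gaussWeight A x * MvPolynomial.eval x (U ^ n)) := by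
  simp only [pertIntegrand, map_smul, PowerSeries.coeff_rescale, PowerSeries.coeff_exp, map_pow,
    smul_eq_mul, one_div, map_inv₀, map_natCast]
  ring

lemma coeff_formalPertIntegrand (A : Matrix (Fin d) (Fin d) ℝ) (U : MvPowerSeries (Fin d) ℝ)
    (x : Fin d → ℝ) (n m : ℕ) :
    PowerSeries.coeff m (PowerSeries.coeff n (formalPertIntegrand A U x)) =
      (n ! : ℝ)⁻¹ * (gaussWeight A x * MvPolynomial.eval x (homogeneousPart (U ^ n) m)) := by
  have hsmul : ∀ (r : ℝ) (f : PowerSeries (PowerSeries ℝ)),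
      PowerSeries.coeff m (PowerSeries.coeff n (r • f)) =
        r * PowerSeries.coeff m (PowerSeries.coeff n f) := fun r f => rfl
  -- Ring homomorphisms out of `ℚ` are unique, so `1 / n!` is a constant series in `t`.
  have halg : algebraMap ℚ (PowerSeries ℝ) (1 / n !) = PowerSeries.C ((n ! : ℝ)⁻¹) := by
    have := RingHom.congr_fun (RingHom.ext_rat (algebraMap ℚ (PowerSeries ℝ))
      ((PowerSeries.C (R := ℝ)).comp (algebraMap ℚ ℝ))) (1 / n !)
    simpa using this
  rw [formalPertIntegrand, hsmul, PowerSeries.coeff_rescale, PowerSeries.coeff_exp, halg,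
    ← scaledPotential_pow, PowerSeries.coeff_mul_C, coeff_scaledPotential]
  ring

lemma integrable_coeff_pertIntegrand (hA : A.PosDef) (U : MvPolynomial (Fin d) ℝ) (n : ℕ) :
    Integrable fun x : Fin d → ℝ => PowerSeries.coeff n (pertIntegrand A U x) := by
  simp_rw [coeff_pertIntegrand]
  exact (integrable_gaussWeight_mul_eval hA _).const_mul _

lemma integrable_coeff_formalPertIntegrand (hA : A.PosDef) (U : MvPowerSeries (Fin d) ℝ)
    (n m : ℕ) : Integrable fun x : Fin d → ℝ =>
      PowerSeries.coeff m (PowerSeries.coeff n (formalPertIntegrand A U x)) := by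
  simp_rw [coeff_formalPertIntegrand]
  exact (integrable_gaussWeight_mul_eval hA _).const_mul _

lemma coeff_partitionFunction (hA : A.PosDef) (U : MvPolynomial (Fin d) ℝ) (n : ℕ) :
    PowerSeries.coeff n (partitionFunction A U) = (n ! : ℝ)⁻¹ * gaussMoment hA (U ^ n) := by
  simp_rw [partitionFunction, PowerSeries.coeff_mk, coeff_pertIntegrand]
  exact integral_const_mul _ _

lemma coeff_formalPartitionFunction (hA : A.PosDef) (U : MvPowerSeries (Fin d) ℝ) (n m : ℕ) :
    PowerSeries.coeff m (PowerSeries.coeff n (formalPartitionFunction A U)) =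
      (n ! : ℝ)⁻¹ * gaussMoment hA (homogeneousPart (U ^ n) m) := by
  simp_rw [formalPartitionFunction, PowerSeries.coeff_mk, coeff_formalPertIntegrand]
  exact integral_const_mul _ _

end Integrands

/-! ### Moments as sums over incidence maps -/

section LabelSums

variable {d : ℕ} {A : Matrix (Fin d) (Fin d) ℝ}

/-- `∑_{labels} ∏_v U_v ∏_e A⁻¹_e` for the graph with incidence map `f`, with no condition on the
valences. -/
noncomputable def labelSum (A : Matrix (Fin d) (Fin d) ℝ) (U : MvPowerSeries (Fin d) ℝ)
    {n k : ℕ} (f : Fin k × Bool → Fin n) : ℝ :=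
  ∑ l : Fin k × Bool → Fin d,
    (∏ v, potentialCoeff U
      (∑ h ∈ Finset.univ.filter fun h => f h = v, Finsupp.single (l h) 1)) *
    ∏ e, A⁻¹ (l (e, false)) (l (e, true))

/-- Functions on edge ends as pairs of functions on the edges. -/
def edgeEndsArrowEquiv (k : ℕ) (α : Type*) : (Fin k → α × α) ≃ (Fin k × Bool → α) where
  toFun p h := bif h.2 then (p h.1).2 else (p h.1).1
  invFun l e := (l (e, false), l (e, true))
  left_inv _ := rfl
  right_inv l := by
    ext ⟨e, b⟩
    cases b <;> rfl

/-- Wick's theorem supplies the edges and their labels; the Leibniz rule attaches each edge end to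
one of the `n` factors `U`. -/
lemma gaussMoment_homogeneousPart_pow (hA : A.PosDef) (U : MvPowerSeries (Fin d) ℝ) (n k : ℕ) :
    (2 ^ k * k ! : ℝ) * gaussMoment hA (homogeneousPart (U ^ n) (2 * k)) =
      gaussIntegral A * ∑ f : Fin k × Bool → Fin n, labelSum A U f := by
  rw [gaussMoment_of_isHomogeneous_two_mul hA k (homogeneousPart_isHomogeneous _ _)]
  simp only [labelSum]
  rw [Finset.sum_comm]
  congr 1
  refine Fintype.sum_equiv (edgeEndsArrowEquiv k (Fin d)) _ _ fun p => ?_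
  have hsum : ∑ e, (Finsupp.single (p e).1 1 + Finsupp.single (p e).2 1) =
      ∑ h, Finsupp.single (edgeEndsArrowEquiv k (Fin d) p h) 1 := by
    rw [Fintype.sum_prod_type]
    exact Finset.sum_congr rfl fun e _ => by
      simp [edgeEndsArrowEquiv, add_comm]
  -- The multi-index has degree exactly `2k`, so `Uⁿ` may replace its homogeneous part.
  have hdeg : (∑ h, Finsupp.single (edgeEndsArrowEquiv k (Fin d) p h) 1).degree = 2 * k := by
    simp [map_sum, mul_comm]
  have hpow : U ^ n = ∏ _v : Fin n, U := by simp
  rw [← Finset.sum_mul, hsum, potentialCoeff_homogeneousPart _ hdeg, hpow, potentialCoeff_prod,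
    mul_comm]
  rfl

lemma sum_range_two_mul {M : Type*} [AddCommMonoid M] (g : ℕ → M) (K : ℕ) :
    ∑ m ∈ Finset.range (2 * K), g m = ∑ k ∈ Finset.range K, (g (2 * k) + g (2 * k + 1)) := by
  induction K with
  | zero => simp
  | succ K ih =>
    rw [Finset.sum_range_succ, ← ih, Nat.mul_succ, Finset.sum_range_succ, Finset.sum_range_succ,
      add_assoc]

/-- The sum of `labelSum` over all incidence maps, divided by the number of symmetries. -/
noncomputable def normalizedLabelSum (A : Matrix (Fin d) (Fin d) ℝ)
    (U : MvPowerSeries (Fin d) ℝ) (n k : ℕ) : ℝ :=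
  (n ! * (2 ^ k * k !) : ℝ)⁻¹ * ∑ f : Fin k × Bool → Fin n, labelSum A U f

lemma coeff_formalPartitionFunction_even (hA : A.PosDef) (U : MvPowerSeries (Fin d) ℝ)
    (n k : ℕ) :
    PowerSeries.coeff (2 * k) (PowerSeries.coeff n (formalPartitionFunction A U)) =
      gaussIntegral A * normalizedLabelSum A U n k := by
  have h := gaussMoment_homogeneousPart_pow hA U n k
  have h0 : (2 ^ k * k ! : ℝ) ≠ 0 := by positivity
  rw [coeff_formalPartitionFunction hA, normalizedLabelSum, mul_left_comm, ← h, mul_inv, mul_assoc,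
    inv_mul_cancel_left₀ h0]

lemma coeff_formalPartitionFunction_odd (hA : A.PosDef) (U : MvPowerSeries (Fin d) ℝ)
    (n k : ℕ) :
    PowerSeries.coeff (2 * k + 1) (PowerSeries.coeff n (formalPartitionFunction A U)) = 0 := by
  rw [coeff_formalPartitionFunction hA,
    gaussMoment_eq_zero_of_odd hA k (homogeneousPart_isHomogeneous _ _), mul_zero]

lemma coeff_partitionFunction_eq_sum (hA : A.PosDef) (U : MvPolynomial (Fin d) ℝ) {n K : ℕ}
    (hK : (U ^ n).totalDegree < 2 * K) :
    PowerSeries.coeff n (partitionFunction A U) =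
      gaussIntegral A * ∑ k ∈ Finset.range K, normalizedLabelSum A U n k := by
  have hcoe : ((U ^ n : MvPolynomial (Fin d) ℝ) : MvPowerSeries (Fin d) ℝ) =
      (U : MvPowerSeries (Fin d) ℝ) ^ n := MvPolynomial.coe_pow _
  rw [coeff_partitionFunction hA, ← sum_range_homogeneousPart _ hK, sum_range_two_mul,
    map_sum, Finset.mul_sum, Finset.mul_sum]
  refine Finset.sum_congr rfl fun k _ => ?_
  rw [map_add, hcoe, gaussMoment_eq_zero_of_odd hA k (homogeneousPart_isHomogeneous _ _),
    add_zero, ← coeff_formalPartitionFunction hA, coeff_formalPartitionFunction_even hA]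

end LabelSums

/-! ### Graph isomorphisms and orbit counting -/

namespace FeynmanGraph

section EdgeEnds

variable {k k' : ℕ}

/-- A bijection of edge ends which takes edges to edges. -/
abbrev EndsEquiv (k k' : ℕ) : Type :=
  {σ : Fin k × Bool ≃ Fin k' × Bool // ∀ h, σ (otherEnd h) = otherEnd (σ h)}

lemma EndsEquiv.symm_otherEnd (σ : EndsEquiv k k') (h : Fin k' × Bool) :
    σ.1.symm (otherEnd h) = otherEnd (σ.1.symm h) := by
  rw [Equiv.symm_apply_eq, σ.2, Equiv.apply_symm_apply]

lemma fst_apply_of_map_otherEnd {σ : Fin k × Bool → Fin k' × Bool}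
    (hσ : ∀ h, σ (otherEnd h) = otherEnd (σ h)) (h : Fin k × Bool) :
    (σ (h.1, false)).1 = (σ h).1 := by
  obtain ⟨e, b⟩ := h
  cases b
  · rfl
  · have := hσ (e, true)
    simp only [otherEnd, Bool.not_true] at this
    rw [this]

/-- The image of one end of an edge determines that of the other, leaving a target edge and an
orientation bit. -/
lemma apply_of_map_otherEnd {σ : Fin k × Bool → Fin k' × Bool}
    (hσ : ∀ h, σ (otherEnd h) = otherEnd (σ h)) (e : Fin k) (b : Bool) :
    σ (e, b) = ((σ (e, false)).1, xor b (σ (e, false)).2) := by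
  cases b
  · simp
  · have := hσ (e, false)
    simp only [otherEnd, Bool.not_false] at this
    simp [this]

/-- The bijection of edges induced by a bijection of edge ends. -/
def EndsEquiv.onEdges (σ : EndsEquiv k k') : Fin k ≃ Fin k' where
  toFun e := (σ.1 (e, false)).1
  invFun e := (σ.1.symm (e, false)).1
  left_inv e := by
    simp only
    rw [fst_apply_of_map_otherEnd σ.symm_otherEnd, Equiv.symm_apply_apply]
  right_inv e := by
    simp only
    rw [fst_apply_of_map_otherEnd σ.2, Equiv.apply_symm_apply]

/-- A bijection of edge ends is a bijection of the edges together with the choice of the edges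
that are reversed. -/
def endsEquivEquiv (k : ℕ) : EndsEquiv k k ≃ Equiv.Perm (Fin k) × (Fin k → Bool) where
  toFun σ := (σ.onEdges, fun e => (σ.1 (e, false)).2)
  invFun p :=
    ⟨{  toFun := fun h => (p.1 h.1, xor h.2 (p.2 h.1))
        invFun := fun h => (p.1.symm h.1, xor h.2 (p.2 (p.1.symm h.1)))
        left_inv := fun h => by simp
        right_inv := fun h => by simp }, fun h => by simp [otherEnd]⟩
  left_inv σ := by
    ext1
    ext1 ⟨e, b⟩
    exact (apply_of_map_otherEnd σ.2 e b).symm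
  right_inv p := by
    refine Prod.ext (Equiv.ext fun e => rfl) (funext fun e => ?_)
    simp

lemma card_endsEquiv (k : ℕ) : Nat.card (EndsEquiv k k) = 2 ^ k * k ! := by
  rw [Nat.card_congr (endsEquivEquiv k), Nat.card_prod, Nat.card_perm, Nat.card_fun]
  simp [mul_comm]

end EdgeEnds

namespace Iso

variable {Γ Δ : FeynmanGraph}

instance : Finite (Iso Γ Δ) :=
  Finite.of_injective (fun f => (f.onVertices, f.onEnds)) fun f g h => by
    cases f
    cases g
    simp_all

lemma numVertices_eq (f : Iso Γ Δ) : Γ.numVertices = Δ.numVertices :=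
  Fin.equiv_iff_eq.mp ⟨f.onVertices⟩

lemma numEdges_eq (f : Iso Γ Δ) : Γ.numEdges = Δ.numEdges :=
  Fin.equiv_iff_eq.mp ⟨EndsEquiv.onEdges ⟨f.onEnds, f.map_otherEnd⟩⟩

/-- Composition with `f` makes the isomorphisms a torsor under the automorphisms. -/
lemma card_eq_autCard (f : Iso Γ Δ) : Nat.card (Iso Γ Δ) = Γ.autCard :=
  Nat.card_congr
    { toFun := fun g => g.trans f.symm
      invFun := fun g => g.trans f
      left_inv := fun g => by
        cases g
        simp [Iso.trans, Iso.symm, Equiv.trans_assoc]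
      right_inv := fun g => by
        cases g
        simp [Iso.trans, Iso.symm, Equiv.trans_assoc] }

lemma labelSum_eq {d : ℕ} {A : Matrix (Fin d) (Fin d) ℝ} (hA : A.PosDef)
    (U : MvPowerSeries (Fin d) ℝ) (f : Iso Γ Δ) :
    labelSum A U Γ.vertex = labelSum A U Δ.vertex := by
  have hsymm : ∀ i j, A⁻¹ i j = A⁻¹ j i := fun i j => by
    simpa using (hA.inv.isHermitian.apply i j).symm
  refine Fintype.sum_equiv (f.onEnds.arrowCongr (Equiv.refl (Fin d))) _ _ fun l => ?_
  congr 1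
  · refine Fintype.prod_equiv f.onVertices _ _ fun v => ?_
    congr 1
    simp only [Finset.sum_filter]
    refine Fintype.sum_equiv f.onEnds _ _ fun h => ?_
    simp [← f.map_vertex]
  · refine Fintype.prod_equiv (EndsEquiv.onEdges ⟨f.onEnds, f.map_otherEnd⟩) _ _ fun e => ?_
    have h1 : f.onEnds (e, true) = otherEnd (f.onEnds (e, false)) := f.map_otherEnd (e, false)
    -- An isomorphism may reverse an edge; the symmetry of `A⁻¹` makes this harmless.
    have h2 : ∀ h : Fin Δ.numEdges × Bool, A⁻¹
        (l (f.onEnds.symm (h.1, false))) (l (f.onEnds.symm (h.1, true))) =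
        A⁻¹ (l (f.onEnds.symm h)) (l (f.onEnds.symm (otherEnd h))) := by
      rintro ⟨e', b⟩
      cases b
      · rfl
      · exact hsymm _ _
    have h3 := h2 (f.onEnds (e, false))
    rw [← h1, Equiv.symm_apply_apply, Equiv.symm_apply_apply] at h3
    exact h3.symm

end Iso

/-- The incidence maps of graphs with `n` vertices and `k` edges. -/
abbrev Incidence (n k : ℕ) : Type :=
  {f : Fin k × Bool → Fin n // ∀ v, 3 ≤ (Finset.univ.filter fun h => f h = v).card}

/-- The graph with a given incidence map. -/
def Incidence.graph {n k : ℕ} (f : Incidence n k) : FeynmanGraph := ⟨n, k, f.1, f.2⟩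

/-- The isomorphism class of the graph with a given incidence map. -/
def Incidence.toClass {n k : ℕ} (f : Incidence n k) : FeynmanClass := Quotient.mk _ f.graph

lemma exists_incidence_graph_eq {Γ : FeynmanGraph} {n k : ℕ} (hn : Γ.numVertices = n)
    (hk : Γ.numEdges = k) : ∃ f : Incidence n k, f.graph = Γ := by
  subst hn hk
  exact ⟨⟨Γ.vertex, Γ.valence_ge_three⟩, rfl⟩

lemma three_le_card_comp {n k : ℕ} (f : Incidence n k) (π : Equiv.Perm (Fin n))
    (σ : Equiv.Perm (Fin k × Bool)) (v : Fin n) :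
    3 ≤ (Finset.univ.filter fun h => π (f.1 (σ.symm h)) = v).card := by
  refine (f.2 (π.symm v)).trans_eq (Finset.card_equiv σ fun h => ?_)
  simp [Equiv.eq_symm_apply]

/-- Renumberings of the vertices and the edge ends of a graph correspond to isomorphisms from it
to graphs with the same numbers of vertices and edges. -/
def renumberingEquiv {n k : ℕ} (f : Incidence n k) :
    Equiv.Perm (Fin n) × EndsEquiv k k ≃
      Σ g : {g : Incidence n k // g.toClass = f.toClass}, Iso f.graph g.1.graph where
  toFun p :=
    let g : Incidence n k := ⟨fun h => p.1 (f.1 (p.2.1.symm h)), three_le_card_comp f p.1 p.2.1⟩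
    let i : Iso f.graph g.graph := ⟨p.1, p.2.1, p.2.2, fun h =>
      congrArg (fun h' => p.1 (f.1 h')) (p.2.1.symm_apply_apply h).symm⟩
    ⟨⟨g, Quotient.sound ⟨i.symm⟩⟩, i⟩
  invFun q := (q.2.onVertices, ⟨q.2.onEnds, q.2.map_otherEnd⟩)
  left_inv p := rfl
  right_inv q := by
    obtain ⟨⟨⟨g, hg⟩, hq⟩, π, σ, h1, h2⟩ := q
    change Equiv.Perm (Fin n) at π
    change Equiv.Perm (Fin k × Bool) at σ
    change ∀ h, π (f.1 h) = g (σ h) at h2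
    -- The target incidence map is forced by the isomorphism: `g = π ∘ f ∘ σ⁻¹`.
    have hgf : g = fun h => π (f.1 (σ.symm h)) := funext fun h => by
      have := h2 (σ.symm h)
      rw [Equiv.apply_symm_apply] at this
      exact this.symm
    subst hgf
    rfl

/-- The orbit–stabilizer theorem for renumberings of a graph. -/
lemma card_toClass_fiber_mul_autCard {n k : ℕ} (f : Incidence n k) :
    Nat.card {g : Incidence n k // g.toClass = f.toClass} * f.graph.autCard =
      n ! * (2 ^ k * k !) := by
  classical
  have h := Nat.card_congr (renumberingEquiv f)
  rw [Nat.card_prod, Nat.card_perm, Nat.card_fin, card_endsEquiv, Nat.card_sigma] at h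
  rw [h, Finset.sum_congr rfl (fun g _ => ?_), Finset.sum_const, Finset.card_univ,
    Nat.card_eq_fintype_card, smul_eq_mul]
  -- Every graph in the fibre is isomorphic to `f.graph`, so all summands equal its `autCard`.
  obtain ⟨i⟩ := Quotient.exact g.2
  exact i.symm.card_eq_autCard

end FeynmanGraph

open FeynmanGraph

/-! ### From incidence maps to isomorphism classes -/

section Classes

open Classical in
/-- The isomorphism classes of graphs with `n` vertices and `k` edges. -/
noncomputable def feynmanClasses (n k : ℕ) : Finset FeynmanClass :=
  Finset.univ.image (Incidence.toClass : Incidence n k → FeynmanClass)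

lemma mem_feynmanClasses {n k : ℕ} {q : FeynmanClass} :
    q ∈ feynmanClasses n k ↔ q.out.numVertices = n ∧ q.out.numEdges = k := by
  classical
  simp only [feynmanClasses, Finset.mem_image, Finset.mem_univ, true_and]
  constructor
  · rintro ⟨f, rfl⟩
    obtain ⟨i⟩ := Quotient.exact (Quotient.out_eq f.toClass)
    exact ⟨i.numVertices_eq, i.numEdges_eq⟩
  · rintro ⟨hn, hk⟩
    obtain ⟨f, hf⟩ := exists_incidence_graph_eq hn hk
    exact ⟨f, by rw [Incidence.toClass, hf, Quotient.out_eq]⟩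

variable {d : ℕ} {A : Matrix (Fin d) (Fin d) ℝ}

/-- The factor at `v` is a coefficient of `U` whose degree is the valence of `v`, whatever the
labels. -/
lemma labelSum_eq_zero (A : Matrix (Fin d) (Fin d) ℝ) (U : MvPowerSeries (Fin d) ℝ) {n k : ℕ}
    (f : Fin k × Bool → Fin n) (v : Fin n)
    (hU : ∀ α : Fin d →₀ ℕ, α.degree = (Finset.univ.filter fun h => f h = v).card →
      MvPowerSeries.coeff α U = 0) : labelSum A U f = 0 := by
  refine Finset.sum_eq_zero fun l _ => ?_
  rw [Finset.prod_eq_zero (Finset.mem_univ v), zero_mul]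
  rw [potentialCoeff, hU, mul_zero]
  simp [map_sum]

lemma feynmanWeight_eq (A : Matrix (Fin d) (Fin d) ℝ) (U : MvPowerSeries (Fin d) ℝ)
    (Γ : FeynmanGraph) : feynmanWeight A U Γ = (Γ.autCard : ℝ)⁻¹ * labelSum A U Γ.vertex := by
  rw [feynmanWeight, one_div]
  rfl

lemma sum_labelSum_eq_sum_incidence {U : MvPowerSeries (Fin d) ℝ}
    (hU : ∀ α : Fin d →₀ ℕ, α.degree < 3 → MvPowerSeries.coeff α U = 0) (n k : ℕ) :
    ∑ f : Fin k × Bool → Fin n, labelSum A U f = ∑ f : Incidence n k, labelSum A U f.1 := by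
  rw [← Finset.sum_subtype (Finset.univ.filter fun f : Fin k × Bool → Fin n =>
    ∀ v, 3 ≤ (Finset.univ.filter fun h => f h = v).card) (by simp) (labelSum A U)]
  refine (Finset.sum_filter_of_ne fun f _ hf v => ?_).symm
  by_contra hv
  exact hf (labelSum_eq_zero A U f v fun α hα => hU α (by omega))

/-- The normalized sum over all incidence maps is the sum over isomorphism classes of graphs. -/
lemma normalizedLabelSum_eq_sum_feynmanWeight (hA : A.PosDef) {U : MvPowerSeries (Fin d) ℝ}
    (hU : ∀ α : Fin d →₀ ℕ, α.degree < 3 → MvPowerSeries.coeff α U = 0) (n k : ℕ) :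
    normalizedLabelSum A U n k = ∑ q ∈ feynmanClasses n k, feynmanWeight A U q.out := by
  classical
  rw [normalizedLabelSum, sum_labelSum_eq_sum_incidence hU,
    ← Finset.sum_fiberwise_of_maps_to (s := Finset.univ) (t := feynmanClasses n k)
      (g := Incidence.toClass) (fun f hf => Finset.mem_image_of_mem _ hf), Finset.mul_sum]
  refine Finset.sum_congr rfl fun q hq => ?_
  obtain ⟨hn, hk⟩ := mem_feynmanClasses.mp hq
  obtain ⟨f₀, hf₀⟩ := exists_incidence_graph_eq hn hk
  have hq₀ : q = f₀.toClass := by rw [Incidence.toClass, hf₀, Quotient.out_eq]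
  have hconst : ∀ f ∈ Finset.univ.filter fun f : Incidence n k => f.toClass = q,
      labelSum A U f.1 = labelSum A U f₀.1 := by
    intro f hf
    rw [Finset.mem_filter, hq₀] at hf
    obtain ⟨i⟩ := Quotient.exact hf.2
    exact i.labelSum_eq hA U
  have hcard := card_toClass_fiber_mul_autCard f₀
  rw [Nat.card_eq_fintype_card, Fintype.card_subtype, ← hq₀] at hcard
  have hcard' := congrArg (Nat.cast : ℕ → ℝ) hcard
  push_cast at hcard'
  -- As a nonzero product, this shows that the fibre size and `autCard` are both invertible.
  have hpos : (n ! * (2 ^ k * k !) : ℝ) ≠ 0 := by positivity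
  rw [← hcard'] at hpos
  rw [Finset.sum_congr rfl hconst, Finset.sum_const, nsmul_eq_mul, ← hcard', ← hf₀,
    feynmanWeight_eq]
  change _ = _ * labelSum A U f₀.1
  have h1 := left_ne_zero_of_mul hpos
  have h2 := right_ne_zero_of_mul hpos
  field_simp

end Classes

/-! ### The Feynman expansion -/

section Expansion

variable {d : ℕ}

lemma coeff_feynmanTerm (A : Matrix (Fin d) (Fin d) ℝ) (U : MvPolynomial (Fin d) ℝ)
    (q : FeynmanClass) (n : ℕ) :
    PowerSeries.coeff n (feynmanTerm A U q) =
      if n = q.out.numVertices then feynmanWeight A (U : MvPowerSeries (Fin d) ℝ) q.out else 0 :=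
  PowerSeries.coeff_monomial _ _ _

lemma coeff_formalFeynmanTerm (A : Matrix (Fin d) (Fin d) ℝ) (U : MvPowerSeries (Fin d) ℝ)
    (q : FeynmanClass) (n m : ℕ) :
    PowerSeries.coeff m (PowerSeries.coeff n (formalFeynmanTerm A U q)) =
      if n = q.out.numVertices ∧ m = 2 * q.out.numEdges then feynmanWeight A U q.out else 0 := by
  rw [formalFeynmanTerm, PowerSeries.coeff_monomial]
  by_cases hn : n = q.out.numVertices
  · simp [hn, PowerSeries.coeff_monomial]
  · simp [hn]

/-- A graph whose weight does not vanish has at most `|Γ| deg U / 2` edges. -/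
lemma two_mul_numEdges_le (A : Matrix (Fin d) (Fin d) ℝ) (U : MvPolynomial (Fin d) ℝ)
    {Γ : FeynmanGraph} (hΓ : feynmanWeight A (U : MvPowerSeries (Fin d) ℝ) Γ ≠ 0) :
    2 * Γ.numEdges ≤ Γ.numVertices * U.totalDegree := by
  rw [feynmanWeight_eq] at hΓ
  have hval : ∀ v, (Finset.univ.filter fun h => Γ.vertex h = v).card ≤ U.totalDegree := by
    intro v
    by_contra hv
    refine right_ne_zero_of_mul hΓ (labelSum_eq_zero A _ _ v fun α hα => ?_)
    rw [MvPolynomial.coeff_coe]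
    refine MvPolynomial.coeff_eq_zero_of_totalDegree_lt ?_
    rw [← Finsupp.degree_apply]
    omega
  -- Edge ends are counted vertex by vertex.
  calc 2 * Γ.numEdges = (Finset.univ : Finset (Fin Γ.numEdges × Bool)).card := by
        simp [mul_comm]
    _ = ∑ v, (Finset.univ.filter fun h => Γ.vertex h = v).card :=
        Finset.card_eq_sum_card_fiberwise fun _ _ => Finset.mem_coe.mpr (Finset.mem_univ _)
    _ ≤ ∑ _v : Fin Γ.numVertices, U.totalDegree := Finset.sum_le_sum fun v _ => hval v
    _ = _ := by simp

/-- Convergence is coefficientwise, and each coefficient is a finite sum because `n` and `m` fix the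
numbers of vertices and edges. -/
lemma hasSum_formalFeynmanTerm {A : Matrix (Fin d) (Fin d) ℝ} (hA : A.PosDef)
    {U : MvPowerSeries (Fin d) ℝ}
    (hU : ∀ α : Fin d →₀ ℕ, α.degree < 3 → MvPowerSeries.coeff α U = 0) :
    HasSum (formalFeynmanTerm A U) (PowerSeries.mk fun n => PowerSeries.mk fun m =>
      if Even m then normalizedLabelSum A U n (m / 2) else 0) := by
  rw [PowerSeries.WithPiTopology.hasSum_iff_hasSum_coeff]
  intro n
  rw [PowerSeries.WithPiTopology.hasSum_iff_hasSum_coeff]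
  intro m
  simp only [PowerSeries.coeff_mk, coeff_formalFeynmanTerm]
  rcases Nat.even_or_odd' m with ⟨k, rfl | rfl⟩
  · rw [if_pos (even_two_mul k), Nat.mul_div_cancel_left k two_pos,
      normalizedLabelSum_eq_sum_feynmanWeight hA hU,
      ← Finset.sum_congr rfl fun q hq => if_pos (t := feynmanWeight A U q.out) (e := 0)
        (show n = q.out.numVertices ∧ 2 * k = 2 * q.out.numEdges from
          ⟨(mem_feynmanClasses.mp hq).1.symm, by rw [(mem_feynmanClasses.mp hq).2]⟩)]
    refine hasSum_sum_of_ne_finset_zero fun q hq => if_neg fun h => hq ?_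
    exact mem_feynmanClasses.mpr ⟨h.1.symm, by omega⟩
  · rw [if_neg (by simp)]
    convert! (hasSum_zero : HasSum (fun _ : FeynmanClass => (0 : ℝ)) 0) using 2 with q
    exact if_neg fun h => by omega

lemma finite_setOf_coeff_formalFeynmanTerm_ne_zero (A : Matrix (Fin d) (Fin d) ℝ)
    (U : MvPowerSeries (Fin d) ℝ) (n m : ℕ) :
    {q : FeynmanClass |
      PowerSeries.coeff m (PowerSeries.coeff n (formalFeynmanTerm A U q)) ≠ 0}.Finite := by
  refine (feynmanClasses n (m / 2)).finite_toSet.subset fun q hq => ?_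
  rw [Set.mem_ofPred_eq, coeff_formalFeynmanTerm] at hq
  have h := (ite_ne_right_iff.mp hq).1
  exact mem_feynmanClasses.mpr ⟨h.1.symm, by omega⟩

/-- The Feynman expansion for a formal potential. -/
theorem formalPartitionFunction_eq {A : Matrix (Fin d) (Fin d) ℝ} (hA : A.PosDef)
    {U : MvPowerSeries (Fin d) ℝ}
    (hU : ∀ α : Fin d →₀ ℕ, α.degree < 3 → MvPowerSeries.coeff α U = 0) :
    formalPartitionFunction A U =
      gaussIntegral A • ∑' q : FeynmanClass, formalFeynmanTerm A U q := by
  have hsmul : ∀ (r : ℝ) (f : PowerSeries (PowerSeries ℝ)) (n m : ℕ),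
      PowerSeries.coeff m (PowerSeries.coeff n (r • f)) =
        r * PowerSeries.coeff m (PowerSeries.coeff n f) := fun _ _ _ _ => rfl
  rw [(hasSum_formalFeynmanTerm hA hU).tsum_eq]
  ext n m
  rw [hsmul, PowerSeries.coeff_mk, PowerSeries.coeff_mk]
  rcases Nat.even_or_odd' m with ⟨k, rfl | rfl⟩
  · rw [coeff_formalPartitionFunction_even hA, if_pos (even_two_mul k),
      Nat.mul_div_cancel_left k two_pos]
  · rw [coeff_formalPartitionFunction_odd hA, if_neg (by simp), mul_zero]

open Classical in
/-- A finite set of classes which contains all graphs that contribute to the coefficient of `ħⁿ`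
for a polynomial potential. -/
noncomputable def contributingClasses (U : MvPolynomial (Fin d) ℝ) (n : ℕ) :
    Finset FeynmanClass :=
  (Finset.range (n * U.totalDegree + 1)).biUnion (feynmanClasses n)

lemma mem_contributingClasses {A : Matrix (Fin d) (Fin d) ℝ} {U : MvPolynomial (Fin d) ℝ}
    {n : ℕ} {q : FeynmanClass} (hq : PowerSeries.coeff n (feynmanTerm A U q) ≠ 0) :
    q ∈ contributingClasses U n := by
  classical
  rw [coeff_feynmanTerm] at hq
  obtain ⟨hn, hw⟩ := ite_ne_right_iff.mp hq
  have hle := two_mul_numEdges_le A U hw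
  rw [← hn] at hle
  rw [contributingClasses, Finset.mem_biUnion]
  exact ⟨q.out.numEdges, Finset.mem_range.mpr (by omega),
    mem_feynmanClasses.mpr ⟨hn.symm, rfl⟩⟩

lemma hasSum_feynmanTerm {A : Matrix (Fin d) (Fin d) ℝ} (hA : A.PosDef)
    {U : MvPolynomial (Fin d) ℝ}
    (hU : ∀ α : Fin d →₀ ℕ, α.degree < 3 → MvPolynomial.coeff α U = 0) :
    HasSum (feynmanTerm A U) (PowerSeries.mk fun n =>
      ∑ k ∈ Finset.range (n * U.totalDegree + 1),
        normalizedLabelSum A (U : MvPowerSeries (Fin d) ℝ) n k) := by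
  classical
  rw [PowerSeries.WithPiTopology.hasSum_iff_hasSum_coeff]
  intro n
  have hsum : ∑ q ∈ contributingClasses U n, PowerSeries.coeff n (feynmanTerm A U q) =
      ∑ k ∈ Finset.range (n * U.totalDegree + 1),
        normalizedLabelSum A (U : MvPowerSeries (Fin d) ℝ) n k := by
    rw [contributingClasses, Finset.sum_biUnion]
    · refine Finset.sum_congr rfl fun k _ => ?_
      rw [normalizedLabelSum_eq_sum_feynmanWeight hA fun α hα => by
        rw [MvPolynomial.coeff_coe, hU α hα]]
      refine Finset.sum_congr rfl fun q hq => ?_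
      rw [coeff_feynmanTerm, if_pos (mem_feynmanClasses.mp hq).1.symm]
    · intro k _ k' _ hkk'
      rw [Function.onFun, Finset.disjoint_left]
      exact fun q hq hq' =>
        hkk' ((mem_feynmanClasses.mp hq).2.symm.trans (mem_feynmanClasses.mp hq').2)
  rw [PowerSeries.coeff_mk, ← hsum]
  exact hasSum_sum_of_ne_finset_zero fun q hq => by_contra fun h => hq (mem_contributingClasses h)

/-- The Feynman expansion for a polynomial potential. -/
theorem partitionFunction_eq {A : Matrix (Fin d) (Fin d) ℝ} (hA : A.PosDef)
    {U : MvPolynomial (Fin d) ℝ}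
    (hU : ∀ α : Fin d →₀ ℕ, α.degree < 3 → MvPolynomial.coeff α U = 0) :
    partitionFunction A U = gaussIntegral A • ∑' q : FeynmanClass, feynmanTerm A U q := by
  rw [(hasSum_feynmanTerm hA hU).tsum_eq]
  ext n
  have hdeg := MvPolynomial.totalDegree_pow U n
  -- The cutoff only has to satisfy `deg Uⁿ ≤ n deg U < 2 K`; it matches the range in
  -- `hasSum_feynmanTerm`.
  rw [coeff_partitionFunction_eq_sum hA U (K := n * U.totalDegree + 1) (by omega), map_smul,
    PowerSeries.coeff_mk, smul_eq_mul]

end Expansion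

theorem mainTheorem3 (d : ℕ) (A : Matrix (Fin d) (Fin d) ℝ) (hA : A.PosDef) :
    (∀ U : MvPolynomial (Fin d) ℝ,
      (∀ α : Fin d →₀ ℕ, α.degree < 3 → MvPolynomial.coeff α U = 0) →
        (∀ n : ℕ, Integrable fun x : Fin d → ℝ => PowerSeries.coeff n (pertIntegrand A U x)) ∧
        (∀ n : ℕ, {q : FeynmanClass | PowerSeries.coeff n (feynmanTerm A U q) ≠ 0}.Finite) ∧
        Summable (feynmanTerm A U) ∧
        partitionFunction A U = gaussIntegral A • ∑' q : FeynmanClass, feynmanTerm A U q) ∧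
    (∀ U : MvPowerSeries (Fin d) ℝ,
      (∀ α : Fin d →₀ ℕ, α.degree < 3 → MvPowerSeries.coeff α U = 0) →
        (∀ n m : ℕ, Integrable fun x : Fin d → ℝ =>
          PowerSeries.coeff m (PowerSeries.coeff n (formalPertIntegrand A U x))) ∧
        (∀ n m : ℕ, {q : FeynmanClass |
          PowerSeries.coeff m (PowerSeries.coeff n (formalFeynmanTerm A U q)) ≠ 0}.Finite) ∧
        Summable (formalFeynmanTerm A U) ∧
        formalPartitionFunction A U =
          gaussIntegral A • ∑' q : FeynmanClass, formalFeynmanTerm A U q) := by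
  refine ⟨fun U hU => ⟨integrable_coeff_pertIntegrand hA U, fun n => ?_,
      (hasSum_feynmanTerm hA hU).summable, partitionFunction_eq hA hU⟩,
    fun U hU => ⟨integrable_coeff_formalPertIntegrand hA U,
      finite_setOf_coeff_formalFeynmanTerm_ne_zero A U,
      (hasSum_formalFeynmanTerm hA hU).summable, formalPartitionFunction_eq hA hU⟩⟩
  exact (contributingClasses U n).finite_toSet.subset fun q hq => mem_contributingClasses hq
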